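/- Let $\mathbb D=\{z\in\mathbb C:|z|<1\}$ and let $A^2(\mathbb D)$ be the Bergman space of holomorphic functions $f$ on $\mathbb D$ with $\|f\|^2=\frac1\pi\int_{\mathbb D}|f(z)|^2\,dz<\infty$, where $dz$ is the area measure. Let $k(z,w)=(1-z\bar w)^{-2}$ be its reproducing kernel. Let $\mathcal P_n$ be the space of polynomials of degree at most $n$, with the norm of $A^2(\mathbb D)$ and reproducing kernel $k_n(z,w)=\sum_{j=0}^n(j+1)(z\bar w)^j$. A set $\Lambda\subseteq\mathbb D$ is called a *sampling set* for $A^2(\mathbb D)$ if there are constants $A,B>0$ such that $$A\|f\|^2\le\sum_{\lambda\in\Lambda}\frac{|f(\lambda)|^2}{k(\lambda,\lambda)}\le B\|f\|^2\qquad\text{for all } f\in A^2(\mathbb D).$$ A sequence $(\Lambda_n)$ of subsets of $\mathbb D$ is called a *Marcinkiewicz–Zygmund (MZ) family* for the polynomials $\mathcal P_n$ in $A^2(\mathbb D)$ if there are constants $A,B>0$ and $n_0\in\mathbb N$ such that, for all $n\ge n_0$, $\Lambda_n$ is finite and $$A\|p\|^2\le\sum_{\lambda\in\Lambda_n}\frac{|p(\lambda)|^2}{k_n(\lambda,\lambda)}\le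 B\|p\|^2\qquad\text{for all } p\in\mathcal P_n.$$ A sequence of sets $\Lambda_n\subseteq\mathbb D$ *converges weakly* to $\Lambda\subseteq\mathbb D$, and $\Lambda$ is then called a weak limit of it, if for every compact disk $D\subseteq\mathbb D$ (of positive radius) the Hausdorff distance between $(\Lambda_n\cap D)\cup\partial D$ and $(\Lambda\cap D)\cup\partial D$ (for the Euclidean metric) tends to $0$ as $n\to\infty$. **Theorem.** (i) Let $\Lambda\subseteq\mathbb D$ be a sampling set for $A^2(\mathbb D)$. Then there is $\gamma_0>0$ such that for every $\gamma\in(0,\gamma_0)$ the sets $\Lambda_n=\Lambda\cap\{z:|z|<1-\gamma/n\}$ form an MZ family for the polynomials $\mathcal P_n$ in $A^2(\mathbb D)$. (ii) Conversely, let $(\Lambda_n)$ be an MZ family for the polynomials $\mathcal P_n$ in $A^2(\mathbb D)$. Then every set $\Lambda\subseteq\mathbb D$ that is a weak limit of $(\Lambda_n)$ or of a subsequence $(\Lambda_{n_j})$ is a sampling set for $A^2(\mathbb D)$. -/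

import Mathlib

open Filter Topology MeasureTheory

noncomputable section

namespace BergmanMZ

/-- The open unit disk `𝔻`. -/
def disk : Set ℂ := Metric.ball 0 1

/-- The squared norm of the Bergman space, `(1/π) ∫_𝔻 |f|²` with respect to area measure. -/
def normSq (f : ℂ → ℂ) : ℝ := (1 / Real.pi) * ∫ z in disk, ‖f z‖ ^ 2

/-- Membership in the Bergman space `A²(𝔻)`: `f` is holomorphic and square integrable on the
disk. (The values of `f` outside of the disk play no role.) -/
def MemBergman (f : ℂ → ℂ) : Prop :=
  DifferentiableOn ℂ f disk ∧ IntegrableOn (fun z => ‖f z‖ ^ 2) disk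

/-- The reproducing kernel `k(z,w) = (1 - z w̄)⁻²` of `A²(𝔻)`. -/
def kernel (z w : ℂ) : ℂ := 1 / (1 - z * (starRingEnd ℂ) w) ^ 2

/-- The reproducing kernel `k_n(z,w) = ∑_{j ≤ n} (j+1) (z w̄)^j` of the space of polynomials of
degree at most `n`, regarded as a subspace of `A²(𝔻)`. -/
def polyKernel (n : ℕ) (z w : ℂ) : ℂ :=
  ∑ j ∈ Finset.range (n + 1), ((j : ℂ) + 1) * (z * (starRingEnd ℂ) w) ^ j

/-- The sampling sum `∑_{λ ∈ Λ} |f(λ)|² / K(λ,λ)`, a sum of nonnegative terms with a value in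
`[0,∞]`. The diagonal of each kernel above is real and positive in the disk. -/
def samplingSum (K : ℂ → ℂ → ℂ) (Λ : Set ℂ) (f : ℂ → ℂ) : ENNReal :=
  ∑' z : Λ, ENNReal.ofReal (‖f z‖ ^ 2 / (K z z).re)

/-- `Λ ⊆ 𝔻` is a sampling set for `A²(𝔻)`. -/
def IsSampling (Λ : Set ℂ) : Prop :=
  Λ ⊆ disk ∧ ∃ A B : ℝ, 0 < A ∧ 0 < B ∧ ∀ f : ℂ → ℂ, MemBergman f →
    ENNReal.ofReal (A * normSq f) ≤ samplingSum kernel Λ f ∧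
      samplingSum kernel Λ f ≤ ENNReal.ofReal (B * normSq f)

/-- `(Λ_n)` is a Marcinkiewicz–Zygmund family for the polynomials of degree at most `n` in
`A²(𝔻)`: the constants `A`, `B` do not depend on `n`, and the conditions are imposed for all
large `n`. -/
def IsMZFamily (Λ : ℕ → Set ℂ) : Prop :=
  (∀ n, Λ n ⊆ disk) ∧ ∃ A B : ℝ, 0 < A ∧ 0 < B ∧ ∃ n₀ : ℕ, ∀ n, n₀ ≤ n →
    (Λ n).Finite ∧ ∀ p : Polynomial ℂ, p.natDegree ≤ n →
      ENNReal.ofReal (A * normSq (fun z => p.eval z)) ≤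
          samplingSum (polyKernel n) (Λ n) (fun z => p.eval z) ∧
        samplingSum (polyKernel n) (Λ n) (fun z => p.eval z) ≤
          ENNReal.ofReal (B * normSq (fun z => p.eval z))

/-- Weak convergence of subsets of the disk: for each compact disk `D ⊆ 𝔻`, the Hausdorff
distance of `(Λ_n ∩ D) ∪ ∂D` and `(Λ ∩ D) ∪ ∂D` tends to zero. -/
def WeaklyConverges (Λs : ℕ → Set ℂ) (Λ : Set ℂ) : Prop :=
  ∀ (c : ℂ) (r : ℝ), 0 < r → Metric.closedBall c r ⊆ disk →
    Tendsto (fun n => Metric.hausdorffEDist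
        ((Λs n ∩ Metric.closedBall c r) ∪ Metric.sphere c r)
        ((Λ ∩ Metric.closedBall c r) ∪ Metric.sphere c r))
      atTop (𝓝 0)

end BergmanMZ

end

/-!
In terms of Taylor coefficients, `‖f‖² = ∑ |a_j|² / (j + 1)`, so multiplication by `z ^ m` shrinks
the squared norm of a polynomial of degree at most `d` by the factor `(d + 1) / (d + 1 + m)`. On
the set where `|z| ^ (2 m) ≥ 1 / 2` it costs only a factor `2` pointwise. The upper sampling
inequality for `z ^ m p` therefore makes the contribution to the sampling sum of `p` of the points
near the circle small compared with `‖p‖²`, and the lower inequality survives their removal.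

At the remaining points the kernels `k` and `k_n` are comparable, because
`(1 - x) ^ 2 ∑_{j ≤ n} (j + 1) x ^ j` lies between `(1 - x ^ (n / 2 + 1)) ^ 2` and `1`. With
`d = n` and `m` a multiple of `n + 1` this gives (i). For (ii), take `p` fixed and `n → ∞`: the
upper inequality passes to a weak limit by Fatou's lemma. For the lower one, several points of
`Λ_n` may collapse to one point of `Λ`, but boundedly many: test the upper inequality on a
polynomial approximating the reproducing kernel at the limit point. Finally, polynomials are dense.
-/

namespace BergmanMZ

open scoped ENNReal

section Parseval

lemma hasSum_coeff_mul_pow (p : Polynomial ℂ) (z : ℂ) :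
    HasSum (fun j => p.coeff j * z ^ j) (p.eval z) := by
  rw [Polynomial.eval_eq_sum_range]
  refine hasSum_sum_of_ne_finset_zero (s := Finset.range (p.natDegree + 1)) fun j hj => ?_
  rw [Polynomial.coeff_eq_zero_of_natDegree_lt (by simpa using hj), zero_mul]

lemma eval_trunc_mk (a : ℕ → ℂ) (N : ℕ) (z : ℂ) :
    ((PowerSeries.mk a).trunc N).eval z = ∑ j ∈ Finset.range N, a j * z ^ j := by
  induction N with
  | zero => simp
  | succ N ih => simp [PowerSeries.trunc_succ, Finset.sum_range_succ, ih]

lemma hasSum_sq_norm_circleAverage {a : ℕ → ℂ} {f : ℂ → ℂ} (hs : Summable fun j => ‖a j‖)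
    (hf : ∀ z : ℂ, ‖z‖ = 1 → HasSum (fun j => a j * z ^ j) (f z)) :
    HasSum (fun j => ‖a j‖ ^ 2) (Real.circleAverage (fun z => ‖f z‖ ^ 2) 0 1) := by
  rw [hasSum_iff_tendsto_nat_of_nonneg fun j => by positivity]
  have hpoly : ∀ N, ∑ j ∈ Finset.range N, ‖a j‖ ^ 2 =
      Real.circleAverage (fun z => ‖∑ j ∈ Finset.range N, a j * z ^ j‖ ^ 2) 0 1 := by
    intro N
    have h := ((PowerSeries.mk a).trunc N).sum_sq_norm_coeff_eq_circleAverage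
    simp only [eval_trunc_mk] at h
    rw [← h, Finset.sum_subset (s₁ := ((PowerSeries.mk a).trunc N).support)
      (s₂ := Finset.range N)]
    · refine Finset.sum_congr rfl fun j hj => ?_
      rw [PowerSeries.coeff_trunc, if_pos (Finset.mem_range.mp hj), PowerSeries.coeff_mk]
    · intro j hj
      contrapose! hj
      simp_all [PowerSeries.coeff_trunc]
    · intro j _ hj
      simpa using hj
  simp only [hpoly, Real.circleAverage_def]
  refine (intervalIntegral.tendsto_integral_filter_of_dominated_convergence
    (fun _ => (∑' j, ‖a j‖) ^ 2) (.of_forall fun N => ?_) (.of_forall fun N => .of_forall ?_)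
    (by simp) (.of_forall ?_)).const_smul _
  · exact (by fun_prop : Continuous _).aestronglyMeasurable
  · intro θ _
    rw [Real.norm_of_nonneg (by positivity)]
    gcongr
    calc _ ≤ ∑ j ∈ Finset.range N, ‖a j * circleMap 0 1 θ ^ j‖ := norm_sum_le _ _
      _ = ∑ j ∈ Finset.range N, ‖a j‖ := by simp
      _ ≤ ∑' j, ‖a j‖ := hs.sum_le_tsum _ fun _ _ => norm_nonneg _
  · intro θ _
    exact ((hf _ (by simp)).tendsto_sum_nat.norm.pow 2)

lemma hasSum_sq_norm_mul_pow_circleAverage {a : ℕ → ℂ} {f : ℂ → ℂ} {ρ : ℝ}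
    (hs : Summable fun j => ‖a j * (ρ : ℂ) ^ j‖)
    (hf : ∀ z : ℂ, ‖z‖ = |ρ| → HasSum (fun j => a j * z ^ j) (f z)) :
    HasSum (fun j => ‖a j‖ ^ 2 * ρ ^ (2 * j)) (Real.circleAverage (fun z => ‖f z‖ ^ 2) 0 ρ) := by
  have h := hasSum_sq_norm_circleAverage (f := fun z => f (ρ * z)) hs fun z hz => by
    simpa [mul_pow, mul_assoc] using hf (ρ * z) (by simp [hz])
  rw [Real.circleAverage_eq_circleAverage_zero_one]
  simpa [mul_pow, pow_mul, pow_right_comm _ _ 2, mul_comm] using h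

lemma lintegral_eq_lintegral_circleMap {g : ℂ → ℝ≥0∞} (hg : Measurable g) :
    ∫⁻ z, g z = ∫⁻ ρ in Set.Ioi 0,
      ENNReal.ofReal ρ * ∫⁻ θ in Set.Ioo (-Real.pi) Real.pi, g (circleMap 0 ρ θ) := by
  have hsymm : ∀ p : ℝ × ℝ, Complex.polarCoord.symm p = circleMap 0 p.1 p.2 := fun p => by
    simp [circleMap, Complex.exp_mul_I]
  have hmeas : Measurable fun p : ℝ × ℝ => ENNReal.ofReal p.1 * g (circleMap 0 p.1 p.2) :=
    .mul (by fun_prop) (hg.comp (by unfold circleMap; fun_prop))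
  rw [← Complex.lintegral_comp_polarCoord_symm, polarCoord_target, Measure.volume_eq_prod,
    ← Measure.prod_restrict]
  simp only [hsymm, smul_eq_mul]
  rw [lintegral_prod _ hmeas.aemeasurable]
  refine lintegral_congr fun ρ => ?_
  exact lintegral_const_mul' _ _ ENNReal.ofReal_ne_top

lemma mem_disk {z : ℂ} : z ∈ disk ↔ ‖z‖ < 1 := by simp [disk]

lemma measurableSet_disk : MeasurableSet disk := measurableSet_ball

variable {a : ℕ → ℂ} {f : ℂ → ℂ}

lemma lintegral_sq_norm_circleMap (hf : ContinuousOn f disk)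
    (ha : ∀ z ∈ disk, HasSum (fun j => a j * z ^ j) (f z)) {ρ : ℝ} (h₀ : 0 ≤ ρ) (h₁ : ρ < 1) :
    ∫⁻ θ in Set.Ioo (-Real.pi) Real.pi, ENNReal.ofReal (‖f (circleMap 0 ρ θ)‖ ^ 2) =
      ∑' j, ENNReal.ofReal (2 * Real.pi * (‖a j‖ ^ 2 * ρ ^ (2 * j))) := by
  have hρ : (ρ : ℂ) ∈ disk := by rwa [mem_disk, Complex.norm_of_nonneg h₀]
  have hsum := (hasSum_sq_norm_mul_pow_circleAverage (ha ρ hρ).summable.norm fun z hz =>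
    ha z (by rwa [mem_disk, hz, abs_of_nonneg h₀])).mul_left (2 * Real.pi)
  have hcont : Continuous fun θ => ‖f (circleMap 0 ρ θ)‖ ^ 2 :=
    (hf.comp_continuous (continuous_circleMap 0 ρ) fun θ => by
      rwa [mem_disk, norm_circleMap_zero, abs_of_nonneg h₀]).norm.pow 2
  have hint : ∫ θ in Set.Ioo (-Real.pi) Real.pi, ‖f (circleMap 0 ρ θ)‖ ^ 2 =
      2 * Real.pi * Real.circleAverage (fun z => ‖f z‖ ^ 2) 0 ρ := by
    rw [← integral_Ioc_eq_integral_Ioo,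
      ← intervalIntegral.integral_of_le (by linarith [Real.pi_pos]),
      Real.circleAverage_eq_integral_add (-Real.pi),
      intervalIntegral.integral_comp_add_right (fun θ => ‖f (circleMap 0 ρ θ)‖ ^ 2),
      smul_eq_mul, mul_inv_cancel_left₀ (by positivity)]
    ring_nf
  rw [← ofReal_integral_eq_lintegral_ofReal, hint, ← hsum.tsum_eq,
    ENNReal.ofReal_tsum_of_nonneg (fun j => by positivity) hsum.summable]
  · exact (hcont.integrableOn_Icc).mono_set Set.Ioo_subset_Icc_self
  · exact .of_forall fun θ => by positivity

lemma lintegral_Ioo_mul_pow {c : ℝ} (hc : 0 ≤ c) (j : ℕ) :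
    ∫⁻ ρ in Set.Ioo 0 1, ENNReal.ofReal (ρ * (2 * Real.pi * (c * ρ ^ (2 * j)))) =
      ENNReal.ofReal (Real.pi * (c / (j + 1))) := by
  have hint : ∫ ρ in (0 : ℝ)..1, ρ * (2 * Real.pi * (c * ρ ^ (2 * j))) =
      Real.pi * (c / (j + 1)) := by
    simp only [show ∀ ρ : ℝ, ρ * (2 * Real.pi * (c * ρ ^ (2 * j))) =
      2 * Real.pi * c * ρ ^ (2 * j + 1) from fun ρ => by ring,
      intervalIntegral.integral_const_mul, integral_pow]
    push_cast
    field_simp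
    ring
  rw [← hint, intervalIntegral.integral_of_le zero_le_one, integral_Ioc_eq_integral_Ioo,
    ofReal_integral_eq_lintegral_ofReal]
  · exact (by fun_prop : Continuous _).integrableOn_Icc.mono_set Set.Ioo_subset_Icc_self
  · filter_upwards [ae_restrict_mem measurableSet_Ioo] with ρ hρ
    have := hρ.1
    positivity

lemma lintegral_disk_sq_norm (hf : ContinuousOn f disk)
    (ha : ∀ z ∈ disk, HasSum (fun j => a j * z ^ j) (f z)) :
    ∫⁻ z in disk, ENNReal.ofReal (‖f z‖ ^ 2) =
      ∑' j, ENNReal.ofReal (Real.pi * (‖a j‖ ^ 2 / (j + 1))) := by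
  have hmeas : Measurable (disk.indicator fun z => ENNReal.ofReal (‖f z‖ ^ 2)) := by
    classical
    rw [← Set.piecewise_eq_indicator]
    exact (ENNReal.continuous_ofReal.comp_continuousOn (hf.norm.pow 2)).measurable_piecewise
      continuousOn_const measurableSet_disk
  calc ∫⁻ z in disk, ENNReal.ofReal (‖f z‖ ^ 2)
    _ = ∫⁻ ρ in Set.Ioi 0, ENNReal.ofReal ρ * ∫⁻ θ in Set.Ioo (-Real.pi) Real.pi,
          disk.indicator (fun z => ENNReal.ofReal (‖f z‖ ^ 2)) (circleMap 0 ρ θ) := by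
      rw [← lintegral_indicator measurableSet_disk]
      exact lintegral_eq_lintegral_circleMap hmeas
    _ = ∫⁻ ρ in Set.Ioi 0, (Set.Ioo (0 : ℝ) 1).indicator (fun ρ =>
          ∑' j, ENNReal.ofReal (ρ * (2 * Real.pi * (‖a j‖ ^ 2 * ρ ^ (2 * j))))) ρ := by
      refine setLIntegral_congr_fun measurableSet_Ioi fun ρ (hρ : 0 < ρ) => ?_
      have hdisk : ∀ θ, circleMap 0 ρ θ ∈ disk ↔ ρ < 1 := fun θ => by
        rw [mem_disk, norm_circleMap_zero, abs_of_pos hρ]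
      by_cases h₁ : ρ < 1
      · simp only [Set.indicator_of_mem ((hdisk _).mpr h₁),
          Set.indicator_of_mem (Set.mem_Ioo.mpr ⟨hρ, h₁⟩), ENNReal.ofReal_mul hρ.le,
          ENNReal.tsum_mul_left, lintegral_sq_norm_circleMap hf ha hρ.le h₁]
      · simp [Set.indicator, hdisk, h₁]
    _ = ∑' j, ∫⁻ ρ in Set.Ioo 0 1, ENNReal.ofReal
          (ρ * (2 * Real.pi * (‖a j‖ ^ 2 * ρ ^ (2 * j)))) := by
      rw [lintegral_indicator measurableSet_Ioo, Measure.restrict_restrict measurableSet_Ioo,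
        Set.inter_eq_left.mpr Set.Ioo_subset_Ioi_self]
      exact lintegral_tsum fun j => (by fun_prop)
    _ = _ := tsum_congr fun j => lintegral_Ioo_mul_pow (sq_nonneg _) j

lemma MemBergman.hasSum_normSq (hf : MemBergman f)
    (ha : ∀ z ∈ disk, HasSum (fun j => a j * z ^ j) (f z)) :
    HasSum (fun j => ‖a j‖ ^ 2 / (j + 1 : ℝ)) (normSq f) := by
  have h := lintegral_disk_sq_norm hf.1.continuousOn ha
  rw [← ofReal_integral_eq_lintegral_ofReal hf.2 (.of_forall fun z => by positivity)] at h
  have hsum := ENNReal.hasSum_toReal (h ▸ ENNReal.ofReal_ne_top)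
  rw [← ENNReal.tsum_toReal_eq fun _ => ENNReal.ofReal_ne_top, ← h,
    ENNReal.toReal_ofReal (integral_nonneg fun z => by positivity)] at hsum
  refine (hsum.mul_left (1 / Real.pi)).congr_fun fun j => ?_
  rw [ENNReal.toReal_ofReal (by positivity)]
  field_simp

lemma exists_hasSum_of_differentiableOn (hf : DifferentiableOn ℂ f disk) :
    ∃ a : ℕ → ℂ, ∀ z ∈ disk, HasSum (fun j => a j * z ^ j) (f z) := by
  refine ⟨fun j => (j.factorial : ℂ)⁻¹ * iteratedDeriv j f 0, fun z hz => ?_⟩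
  refine (Complex.hasSum_taylorSeries_on_ball hf hz).congr_fun fun j => ?_
  rw [sub_zero, smul_eq_mul, smul_eq_mul]
  ring

lemma normSq_nonneg (f : ℂ → ℂ) : 0 ≤ normSq f :=
  mul_nonneg (by positivity) (integral_nonneg fun _ => by positivity)

lemma MemBergman.sub {g : ℂ → ℂ} (hf : MemBergman f) (hg : MemBergman g) :
    MemBergman (fun z => f z - g z) := by
  have hd := hf.1.sub hg.1
  refine ⟨hd, ?_⟩
  refine Integrable.mono' ((hf.2.const_mul 2).add (hg.2.const_mul 2))
    ((hd.continuousOn.norm.pow 2).aestronglyMeasurable measurableSet_disk)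
    (ae_of_all _ fun z => ?_)
  rw [Real.norm_of_nonneg (by positivity)]
  have := norm_sub_le (f z) (g z)
  simp only [Pi.add_apply]
  nlinarith [sq_nonneg (‖f z‖ - ‖g z‖), norm_nonneg (f z - g z)]

lemma memBergman_eval (p : Polynomial ℂ) : MemBergman fun z => p.eval z :=
  ⟨p.differentiable.differentiableOn,
    ((p.continuous.norm.pow 2).continuousOn.integrableOn_compact
      (isCompact_closedBall 0 1)).mono_set Metric.ball_subset_closedBall⟩

lemma hasSum_normSq_eval (p : Polynomial ℂ) :
    HasSum (fun j => ‖p.coeff j‖ ^ 2 / (j + 1 : ℝ)) (normSq fun z => p.eval z) :=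
  (memBergman_eval p).hasSum_normSq fun z _ => hasSum_coeff_mul_pow p z

lemma normSq_X_pow_mul_le {p : Polynomial ℂ} {d : ℕ} (hp : p.natDegree ≤ d) (m : ℕ) :
    normSq (fun z => (Polynomial.X ^ m * p).eval z) ≤
      (d + 1) / (d + 1 + m) * normSq (fun z => p.eval z) := by
  have hshift := (hasSum_nat_add_iff' m).mpr (hasSum_normSq_eval (Polynomial.X ^ m * p))
  rw [Finset.sum_eq_zero fun j hj => ?_, sub_zero] at hshift
  · refine hasSum_le (fun j => ?_) hshift ((hasSum_normSq_eval p).mul_left _)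
    rw [Polynomial.coeff_X_pow_mul]
    rcases le_or_gt j d with hj | hj
    · have hjd : (j : ℝ) ≤ d := by exact_mod_cast hj
      have hgap : 0 ≤ ‖p.coeff j‖ ^ 2 * (m * (d - j)) :=
        mul_nonneg (by positivity) (mul_nonneg (by positivity) (by linarith))
      rw [div_mul_div_comm, div_le_div_iff₀ (by positivity) (by positivity)]
      push_cast
      linarith
    · simp [Polynomial.coeff_eq_zero_of_natDegree_lt (hp.trans_lt hj)]
  · simp [Polynomial.coeff_X_pow_mul', (Finset.mem_range.mp hj).not_ge]

lemma normSq_eval_trunc (a : ℕ → ℂ) (N : ℕ) :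
    normSq (fun z => ((PowerSeries.mk a).trunc N).eval z) =
      ∑ j ∈ Finset.range N, ‖a j‖ ^ 2 / (j + 1 : ℝ) := by
  have h := hasSum_normSq_eval ((PowerSeries.mk a).trunc N)
  rw [← h.tsum_eq, tsum_eq_sum (s := Finset.range N) fun j hj => ?_]
  · refine Finset.sum_congr rfl fun j hj => ?_
    rw [PowerSeries.coeff_trunc, if_pos (Finset.mem_range.mp hj), PowerSeries.coeff_mk]
  · rw [PowerSeries.coeff_trunc, if_neg (by simpa using hj)]
    simp

lemma MemBergman.tendsto_normSq_trunc (hf : MemBergman f)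
    (ha : ∀ z ∈ disk, HasSum (fun j => a j * z ^ j) (f z)) :
    Tendsto (fun N => normSq fun z => ((PowerSeries.mk a).trunc N).eval z) atTop
      (𝓝 (normSq f)) := by
  simpa only [normSq_eval_trunc] using (hf.hasSum_normSq ha).tendsto_sum_nat

lemma MemBergman.tendsto_normSq_sub_trunc (hf : MemBergman f)
    (ha : ∀ z ∈ disk, HasSum (fun j => a j * z ^ j) (f z)) :
    Tendsto (fun N => normSq fun z => f z - ((PowerSeries.mk a).trunc N).eval z) atTop (𝓝 0) := by
  have hdiff : ∀ N, normSq (fun z => f z - ((PowerSeries.mk a).trunc N).eval z) =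
      normSq f - ∑ j ∈ Finset.range N, ‖a j‖ ^ 2 / (j + 1 : ℝ) := by
    intro N
    have hrem := (hf.sub (memBergman_eval ((PowerSeries.mk a).trunc N))).hasSum_normSq
      (a := fun j => a j - ((PowerSeries.mk a).trunc N).coeff j) fun z hz => by
        simpa only [sub_mul] using (ha z hz).sub (hasSum_coeff_mul_pow _ z)
    have hsum := (hasSum_nat_add_iff' N).mpr hrem
    rw [Finset.sum_eq_zero fun j hj => ?_, sub_zero] at hsum
    · refine hsum.unique ?_
      refine ((hasSum_nat_add_iff' N).mpr (hf.hasSum_normSq ha)).congr_fun fun j => ?_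
      simp [PowerSeries.coeff_trunc]
    · simp [PowerSeries.coeff_trunc, Finset.mem_range.mp hj]
  simp only [hdiff]
  simpa using (hf.hasSum_normSq ha).tendsto_sum_nat.const_sub (normSq f)

end Parseval

section SamplingSum

variable {K L : ℂ → ℂ → ℂ} {Λ Λ' : Set ℂ} {f g : ℂ → ℂ}

lemma samplingSum_mono (h : Λ ⊆ Λ') : samplingSum K Λ f ≤ samplingSum K Λ' f :=
  ENNReal.tsum_mono_subtype (fun z => ENNReal.ofReal (‖f z‖ ^ 2 / (K z z).re)) h

lemma samplingSum_le_inter_add_inter (s t : Set ℂ) (h : Λ ⊆ s ∪ t) :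
    samplingSum K Λ f ≤ samplingSum K (Λ ∩ s) f + samplingSum K (Λ ∩ t) f :=
  (samplingSum_mono (by rw [← Set.inter_union_distrib_left]; exact Set.subset_inter le_rfl h)).trans
    (ENNReal.tsum_union_le (fun z => ENNReal.ofReal (‖f z‖ ^ 2 / (K z z).re)) _ _)

lemma samplingSum_le_mul {c : ℝ} (hc : 0 ≤ c)
    (h : ∀ z ∈ Λ, ‖f z‖ ^ 2 / (K z z).re ≤ c * (‖g z‖ ^ 2 / (L z z).re)) :
    samplingSum K Λ f ≤ ENNReal.ofReal c * samplingSum L Λ g := by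
  rw [samplingSum, samplingSum, ← ENNReal.tsum_mul_left]
  refine ENNReal.tsum_le_tsum fun z => ?_
  rw [← ENNReal.ofReal_mul hc]
  exact ENNReal.ofReal_le_ofReal (h z z.2)

lemma samplingSum_le_mul_of_sq_norm_le {c : ℝ} (hc : 0 ≤ c)
    (h : ∀ z ∈ Λ, ‖f z‖ ^ 2 ≤ c * ‖g z‖ ^ 2) :
    samplingSum K Λ f ≤ ENNReal.ofReal c * samplingSum K Λ g := by
  simp only [samplingSum, ← ENNReal.tsum_mul_left, div_eq_mul_inv,
    ENNReal.ofReal_mul (sq_nonneg _), ← mul_assoc, ← ENNReal.ofReal_mul hc]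
  gcongr with z
  exact h z z.2

lemma samplingSum_le_two_mul_add :
    samplingSum K Λ g ≤ 2 * samplingSum K Λ f + 2 * samplingSum K Λ fun z => f z - g z := by
  simp only [samplingSum, ← ENNReal.tsum_mul_left, ← ENNReal.tsum_add, div_eq_mul_inv,
    ENNReal.ofReal_mul (sq_nonneg _), ← mul_assoc, ← add_mul]
  gcongr with z
  have hnorm : ‖g z‖ ≤ ‖f z‖ + ‖f z - g z‖ := by simpa using norm_sub_le (f z) (f z - g z)
  rw [← ENNReal.ofReal_ofNat 2, ← ENNReal.ofReal_mul zero_le_two,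
    ← ENNReal.ofReal_mul zero_le_two, ← ENNReal.ofReal_add (by positivity) (by positivity)]
  gcongr
  calc ‖g z‖ ^ 2 ≤ (‖f z‖ + ‖f z - g z‖) ^ 2 := by gcongr
    _ ≤ 2 * ‖f z‖ ^ 2 + 2 * ‖f z - g z‖ ^ 2 := by
      linarith [add_sq_le (a := ‖f z‖) (b := ‖f z - g z‖)]

lemma re_kernel_self (z : ℂ) : (kernel z z).re = ((1 - ‖z‖ ^ 2) ^ 2)⁻¹ := by
  rw [kernel, Complex.mul_conj', one_div]
  norm_cast

lemma re_polyKernel_self (n : ℕ) (z : ℂ) :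
    (polyKernel n z z).re = ∑ j ∈ Finset.range (n + 1), (j + 1 : ℝ) * (‖z‖ ^ 2) ^ j := by
  rw [polyKernel, Complex.mul_conj']
  norm_cast

lemma hasSum_add_one_mul_pow {x : ℝ} (h₀ : 0 ≤ x) (h₁ : x < 1) :
    HasSum (fun j : ℕ => (j + 1 : ℝ) * x ^ j) ((1 - x) ^ 2)⁻¹ := by
  simpa using hasSum_choose_mul_geometric_of_norm_lt_one 1 (r := x)
    (by rwa [Real.norm_of_nonneg h₀])

lemma sq_geom_sum_le {x : ℝ} (hx : 0 ≤ x) {m n : ℕ} (hmn : 2 * m ≤ n) :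
    (∑ i ∈ Finset.range (m + 1), x ^ i) ^ 2 ≤
      ∑ k ∈ Finset.range (n + 1), (k + 1 : ℝ) * x ^ k := by
  rw [sq, Finset.sum_mul_sum, ← Finset.sum_product',
    ← Finset.sum_fiberwise_of_maps_to (g := fun p : ℕ × ℕ => p.1 + p.2)
      (t := Finset.range (n + 1)) fun p hp => by
        simp only [Finset.mem_product, Finset.mem_range] at hp ⊢
        lia]
  refine Finset.sum_le_sum fun k _ => ?_
  calc ∑ p ∈ Finset.range (m + 1) ×ˢ Finset.range (m + 1) with p.1 + p.2 = k, x ^ p.1 * x ^ p.2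
    _ = ∑ p ∈ Finset.range (m + 1) ×ˢ Finset.range (m + 1) with p.1 + p.2 = k, x ^ k :=
      Finset.sum_congr rfl fun p hp => by rw [← pow_add, (Finset.mem_filter.mp hp).2]
    _ ≤ ∑ _p ∈ Finset.HasAntidiagonal.antidiagonal k, x ^ k :=
      Finset.sum_le_sum_of_subset_of_nonneg
        (fun p hp => by simpa using (Finset.mem_filter.mp hp).2) fun _ _ _ => by positivity
    _ = (k + 1) * x ^ k := by simp

lemma sq_one_sub_pow_le {x : ℝ} (hx : 0 ≤ x) (n : ℕ) :
    (1 - x ^ (n / 2 + 1)) ^ 2 ≤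
      (∑ j ∈ Finset.range (n + 1), (j + 1 : ℝ) * x ^ j) * (1 - x) ^ 2 := by
  rw [← geom_sum_mul_neg, mul_pow]
  gcongr
  exact sq_geom_sum_le hx (by lia)

lemma samplingSum_kernel (Λ : Set ℂ) (f : ℂ → ℂ) :
    samplingSum kernel Λ f = ∑' z : Λ, ENNReal.ofReal (‖f z‖ ^ 2 * (1 - ‖(z : ℂ)‖ ^ 2) ^ 2) := by
  simp only [samplingSum, re_kernel_self, div_inv_eq_mul]

lemma sq_norm_lt_one {z : ℂ} (hz : z ∈ disk) : ‖z‖ ^ 2 < 1 :=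
  pow_lt_one₀ (norm_nonneg z) (mem_disk.mp hz) two_ne_zero

lemma re_polyKernel_self_pos (n : ℕ) (z : ℂ) : 0 < (polyKernel n z z).re := by
  rw [re_polyKernel_self]
  exact Finset.sum_pos' (fun j _ => by positivity) ⟨0, by simp⟩

lemma re_polyKernel_self_le {z : ℂ} (hz : z ∈ disk) (n : ℕ) :
    (polyKernel n z z).re ≤ (kernel z z).re := by
  have h := hasSum_add_one_mul_pow (sq_nonneg ‖z‖) (sq_norm_lt_one hz)
  rw [re_kernel_self, re_polyKernel_self]
  exact sum_le_hasSum _ (fun j _ => by positivity) h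

lemma re_kernel_self_le {z : ℂ} (hz : z ∈ disk) {n : ℕ} {q : ℝ} (hq : q < 1)
    (h : (‖z‖ ^ 2) ^ (n / 2 + 1) ≤ q) :
    (kernel z z).re ≤ ((1 - q) ^ 2)⁻¹ * (polyKernel n z z).re := by
  have hz' : 0 < 1 - ‖z‖ ^ 2 := sub_pos.mpr (sq_norm_lt_one hz)
  have hq' : 0 < 1 - q := sub_pos.mpr hq
  rw [re_kernel_self, re_polyKernel_self, inv_mul_eq_div, le_div_iff₀ (by positivity),
    inv_mul_le_iff₀ (by positivity), mul_comm]
  exact (pow_le_pow_left₀ hq'.le (by linarith) 2).trans (sq_one_sub_pow_le (sq_nonneg _) n)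

lemma samplingSum_kernel_le_polyKernel (hΛ : Λ ⊆ disk) (n : ℕ) :
    samplingSum kernel Λ f ≤ samplingSum (polyKernel n) Λ f := by
  simpa using samplingSum_le_mul (K := kernel) (L := polyKernel n) zero_le_one fun z hz => by
    rw [one_mul]
    exact div_le_div_of_nonneg_left (by positivity) (re_polyKernel_self_pos n z)
      (re_polyKernel_self_le (hΛ hz) n)

lemma samplingSum_polyKernel_le (hΛ : Λ ⊆ disk) {n : ℕ} {q : ℝ} (hq : q < 1)
    (h : ∀ z ∈ Λ, (‖z‖ ^ 2) ^ (n / 2 + 1) ≤ q) :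
    samplingSum (polyKernel n) Λ f ≤
      ENNReal.ofReal ((1 - q) ^ 2)⁻¹ * samplingSum kernel Λ f := by
  refine samplingSum_le_mul (by positivity) fun z hz => ?_
  have hk := (re_polyKernel_self_pos n z).trans_le (re_polyKernel_self_le (hΛ hz) n)
  rw [mul_div_assoc', div_le_div_iff₀ (re_polyKernel_self_pos n z) hk, mul_assoc, mul_left_comm]
  exact mul_le_mul_of_nonneg_left (re_kernel_self_le (hΛ hz) hq (h z hz)) (by positivity)

end SamplingSum

section Carleson

/-- The Carleson (upper sampling) inequality with constant `B` for `Λ` and the kernel `K`, tested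
on the polynomials of degree at most `N`. -/
def IsCarleson (K : ℂ → ℂ → ℂ) (N : ℕ) (B : ℝ) (Λ : Set ℂ) : Prop :=
  ∀ p : Polynomial ℂ, p.natDegree ≤ N →
    samplingSum K Λ (fun z => p.eval z) ≤ ENNReal.ofReal (B * normSq fun z => p.eval z)

variable {K : ℂ → ℂ → ℂ} {A B r : ℝ} {d m N : ℕ} {Λ : Set ℂ} {p : Polynomial ℂ}

lemma IsCarleson.samplingSum_outer_le (h : IsCarleson K (d + m) B Λ) (hB : 0 ≤ B) (hr₀ : 0 ≤ r)
    (hr : 1 / 2 ≤ r ^ (2 * m)) (hp : p.natDegree ≤ d) :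
    samplingSum K (Λ ∩ {z | r ≤ ‖z‖}) (fun z => p.eval z) ≤
      ENNReal.ofReal (2 * (B * ((d + 1) / (d + 1 + m) * normSq fun z => p.eval z))) := by
  have hdeg : (Polynomial.X ^ m * p).natDegree ≤ d + m :=
    Polynomial.natDegree_mul_le.trans (by rw [Polynomial.natDegree_X_pow]; lia)
  have hpt : ∀ z ∈ Λ ∩ {z | r ≤ ‖z‖},
      ‖p.eval z‖ ^ 2 ≤ 2 * ‖(Polynomial.X ^ m * p).eval z‖ ^ 2 := by
    rintro z ⟨-, hz : r ≤ ‖z‖⟩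
    have hzm : 1 / 2 ≤ ‖z‖ ^ (2 * m) := hr.trans (pow_le_pow_left₀ hr₀ hz _)
    rw [Polynomial.eval_mul, Polynomial.eval_pow, Polynomial.eval_X, norm_mul, norm_pow, mul_pow,
      ← pow_mul, mul_comm m 2]
    linarith [mul_le_mul_of_nonneg_right hzm (sq_nonneg ‖p.eval z‖)]
  calc samplingSum K (Λ ∩ {z | r ≤ ‖z‖}) (fun z => p.eval z)
    _ ≤ ENNReal.ofReal 2 *
          samplingSum K (Λ ∩ {z | r ≤ ‖z‖}) (fun z => (Polynomial.X ^ m * p).eval z) :=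
      samplingSum_le_mul_of_sq_norm_le zero_le_two hpt
    _ ≤ ENNReal.ofReal 2 *
          ENNReal.ofReal (B * normSq fun z => (Polynomial.X ^ m * p).eval z) := by
      gcongr
      exact (samplingSum_mono Set.inter_subset_left).trans (h _ hdeg)
    _ ≤ _ := by
      rw [← ENNReal.ofReal_mul zero_le_two]
      gcongr
      exact normSq_X_pow_mul_le hp m

lemma IsCarleson.half_mul_normSq_le_samplingSum_inner (h : IsCarleson K (d + m) B Λ) (hB : 0 ≤ B)
    (hr₀ : 0 ≤ r) (hr : 1 / 2 ≤ r ^ (2 * m)) (hm : 4 * B * (d + 1) ≤ A * (d + 1 + m))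
    (hp : p.natDegree ≤ d)
    (hA : ENNReal.ofReal (A * normSq fun z => p.eval z) ≤ samplingSum K Λ fun z => p.eval z) :
    ENNReal.ofReal (A / 2 * normSq fun z => p.eval z) ≤
      samplingSum K (Λ ∩ {z | ‖z‖ < r}) fun z => p.eval z := by
  have hN := normSq_nonneg fun z => p.eval z
  have htail : samplingSum K (Λ ∩ {z | r ≤ ‖z‖}) (fun z => p.eval z) ≤
      ENNReal.ofReal (A / 2 * normSq fun z => p.eval z) := by
    refine (h.samplingSum_outer_le hB hr₀ hr hp).trans (ENNReal.ofReal_le_ofReal ?_)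
    rw [← mul_assoc, ← mul_assoc]
    gcongr
    rw [mul_div_assoc', div_le_iff₀ (by positivity)]
    linarith
  have hA₀ : 0 ≤ A := by
    by_contra! hA₀
    have : 0 ≤ 4 * B * ((d : ℝ) + 1) := by positivity
    nlinarith
  have hsplit := hA.trans (samplingSum_le_inter_add_inter {z | ‖z‖ < r} {z | r ≤ ‖z‖}
    fun z _ => lt_or_ge ‖z‖ r)
  rw [show A * normSq (fun z => p.eval z) = A / 2 * normSq (fun z => p.eval z) +
    A / 2 * normSq (fun z => p.eval z) by ring, ENNReal.ofReal_add (by positivity)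
    (by positivity)] at hsplit
  exact (ENNReal.add_le_add_iff_right ENNReal.ofReal_ne_top).mp
    (hsplit.trans (add_le_add_right htail _))

lemma IsCarleson.finite_inter_norm_le (h : IsCarleson kernel N B Λ) (hr : r < 1) :
    (Λ ∩ {z | ‖z‖ ≤ r}).Finite := by
  have hone := h 1 (by simp)
  rw [samplingSum_kernel] at hone
  have hfin := ENNReal.finite_const_le_of_tsum_ne_top
    (ne_top_of_le_ne_top ENNReal.ofReal_ne_top hone) (ε := ENNReal.ofReal ((1 - r) ^ 2))
    (ENNReal.ofReal_pos.mpr (pow_pos (sub_pos.mpr hr) 2)).ne'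
  refine (hfin.image Subtype.val).subset fun z ⟨hz, (hzr : ‖z‖ ≤ r)⟩ => ⟨⟨z, hz⟩, ?_, rfl⟩
  have : 1 - r ≤ 1 - ‖z‖ ^ 2 := by nlinarith [norm_nonneg z]
  simpa using ENNReal.ofReal_le_ofReal (pow_le_pow_left₀ (sub_pos.mpr hr).le this 2)

end Carleson

section Truncation

variable {Λ : Set ℂ}

lemma half_le_one_sub_div_pow {γ : ℝ} {M n : ℕ} (hn : n ≠ 0) (hγ₀ : 0 ≤ γ)
    (hγ : γ * (8 * (M + 1)) ≤ 1) : 1 / 2 ≤ (1 - γ / n) ^ (2 * (M * (n + 1))) := by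
  have hn' : (1 : ℝ) ≤ n := by exact_mod_cast Nat.one_le_iff_ne_zero.mpr hn
  have hγn : γ / n ≤ γ := div_le_self hγ₀ hn'
  have hMγ : 0 ≤ M * γ := by positivity
  have hbern := one_add_mul_le_pow (show -2 ≤ -(γ / n) by nlinarith) (2 * (M * (n + 1)))
  rw [← sub_eq_add_neg] at hbern
  refine le_trans ?_ hbern
  have hMn : M * (n * (γ / n)) = M * γ := by field_simp
  push_cast
  nlinarith [mul_le_mul_of_nonneg_left hγn (show (0 : ℝ) ≤ M by positivity)]

lemma sq_norm_pow_le_exp_neg {γ : ℝ} {n : ℕ} {z : ℂ} (hγ : γ ≤ n) (hz : ‖z‖ < 1 - γ / n)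
    (h₁ : ‖z‖ ≤ 1) : (‖z‖ ^ 2) ^ (n / 2 + 1) ≤ Real.exp (-γ) :=
  calc (‖z‖ ^ 2) ^ (n / 2 + 1) = ‖z‖ ^ (2 * (n / 2 + 1)) := (pow_mul _ _ _).symm
    _ ≤ ‖z‖ ^ n := pow_le_pow_of_le_one (norm_nonneg z) h₁ (by lia)
    _ ≤ (1 - γ / n) ^ n := by gcongr
    _ ≤ Real.exp (-γ) := Real.one_sub_div_pow_le_exp_neg hγ

theorem IsSampling.exists_isMZFamily (hΛ : IsSampling Λ) :
    ∃ γ₀ : ℝ, 0 < γ₀ ∧ ∀ γ : ℝ, 0 < γ → γ < γ₀ →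
      IsMZFamily fun n : ℕ => Λ ∩ {z : ℂ | ‖z‖ < 1 - γ / (n : ℝ)} := by
  obtain ⟨hdisk, A, B, hA, hB, hAB⟩ := hΛ
  have hcarl : ∀ N, IsCarleson kernel N B Λ := fun N p _ => (hAB _ (memBergman_eval p)).2
  obtain ⟨M, hM⟩ := exists_nat_ge (4 * B / A)
  rw [div_le_iff₀ hA] at hM
  refine ⟨1 / (8 * (M + 1)), by positivity, fun γ hγ hγM => ?_⟩
  rw [lt_div_iff₀ (by positivity)] at hγM
  have hγ₁ : γ < 1 := by nlinarith
  have hq : Real.exp (-γ) < 1 := Real.exp_lt_one_iff.mpr (neg_lt_zero.mpr hγ)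
  have hc : 0 < ((1 - Real.exp (-γ)) ^ 2)⁻¹ := inv_pos.mpr (pow_pos (sub_pos.mpr hq) 2)
  have hsub : ∀ r : ℝ, Λ ∩ {z | ‖z‖ < r} ⊆ disk := fun _ => Set.inter_subset_left.trans hdisk
  refine ⟨fun n => hsub _, A / 2, ((1 - Real.exp (-γ)) ^ 2)⁻¹ * B, by positivity, by positivity, 1,
    fun n hn => ?_⟩
  have hn' : (1 : ℝ) ≤ n := by exact_mod_cast hn
  have hr : γ / n < 1 := (div_lt_one (by positivity)).mpr (hγ₁.trans_le hn')
  refine ⟨((hcarl 0).finite_inter_norm_le (sub_lt_self 1 (show 0 < γ / n by positivity))).subset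
    fun z ⟨hz, (hzr : ‖z‖ < _)⟩ => ⟨hz, hzr.le⟩, fun p hp => ⟨?_, ?_⟩⟩
  · refine le_trans ?_ (samplingSum_kernel_le_polyKernel (hsub _) n)
    refine (hcarl (n + M * (n + 1))).half_mul_normSq_le_samplingSum_inner hB.le (sub_pos.mpr hr).le
      (half_le_one_sub_div_pow (by lia) hγ.le hγM.le) ?_ hp (hAB _ (memBergman_eval p)).1
    push_cast
    nlinarith
  · rw [mul_assoc, ENNReal.ofReal_mul hc.le]
    refine (samplingSum_polyKernel_le (hsub _) hq fun z hz =>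
      sq_norm_pow_le_exp_neg (hγ₁.le.trans hn') hz.2 (mem_disk.mp (hdisk hz.1)).le).trans ?_
    gcongr
    exact (samplingSum_mono Set.inter_subset_left).trans (hcarl n p hp)

end Truncation

section WeakLimit

variable {M : ℕ → Set ℂ} {Λ : Set ℂ} {g : ℂ → ℝ≥0∞}

lemma exists_mem_dist_lt_of_hausdorffEDist_lt {S T : Set ℂ} {z : ℂ} {R δ : ℝ}
    (h : Metric.hausdorffEDist (S ∩ Metric.closedBall 0 R ∪ Metric.sphere 0 R)
      (T ∩ Metric.closedBall 0 R ∪ Metric.sphere 0 R) < ENNReal.ofReal δ)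
    (hz : z ∈ S) (hzR : ‖z‖ + δ ≤ R) : ∃ w ∈ T, ‖w‖ ≤ R ∧ dist z w < δ := by
  have hδ : 0 < δ := ENNReal.ofReal_pos.mp (zero_le.trans_lt h)
  obtain ⟨w, hw, hzw⟩ := Metric.exists_edist_lt_of_hausdorffEDist_lt (x := z)
    (Or.inl ⟨hz, by rw [mem_closedBall_zero_iff]; linarith⟩) h
  rw [edist_lt_ofReal] at hzw
  rcases hw with hw | hw
  · exact ⟨w, hw.1, mem_closedBall_zero_iff.mp hw.2, hzw⟩
  · rw [mem_sphere_zero_iff_norm] at hw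
    have := norm_sub_norm_le w z
    rw [dist_comm, dist_eq_norm] at hzw
    linarith

lemma WeaklyConverges.eventually_forall_exists_dist_lt (h : WeaklyConverges M Λ) {r R δ : ℝ}
    (hR : 0 < R) (hrR : r < R) (hR₁ : R < 1) (hδ : 0 < δ) :
    ∀ᶠ j in atTop, ∀ w ∈ M j, ‖w‖ ≤ r → ∃ l ∈ Λ, ‖l‖ ≤ R ∧ dist w l < δ := by
  have hε : 0 < min δ (R - r) := lt_min hδ (sub_pos.mpr hrR)
  filter_upwards [(h 0 R hR (Metric.closedBall_subset_ball hR₁)).eventually_lt_const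
    (ENNReal.ofReal_pos.mpr hε)] with j hj w hw hwr
  obtain ⟨l, hl, hlR, hwl⟩ := exists_mem_dist_lt_of_hausdorffEDist_lt hj hw
    (by linarith [min_le_right δ (R - r)])
  exact ⟨l, hl, hlR, hwl.trans_le (min_le_left _ _)⟩

lemma WeaklyConverges.eventually_inter_subset_biUnion (h : WeaklyConverges M Λ) {r R : ℝ}
    (hR : 0 < R) (hrR : r < R) (hR₁ : R < 1) {F : Finset ℂ} (hF : Λ ∩ {z | ‖z‖ ≤ R} ⊆ F)
    {V : ℂ → Set ℂ} (hV : ∀ l ∈ F, V l ∈ 𝓝 l) :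
    ∀ᶠ j in atTop, M j ∩ {z | ‖z‖ < r} ⊆ ⋃ l ∈ F, M j ∩ V l := by
  have hball : ∀ᶠ δ in 𝓝[>] 0, ∀ l ∈ F, Metric.ball l δ ⊆ V l :=
    nhdsWithin_le_nhds ((eventually_all_finset F).mpr fun l hl =>
      eventually_ball_subset (hV l hl))
  obtain ⟨δ, hδV, hδ⟩ := (hball.and self_mem_nhdsWithin).exists
  filter_upwards [h.eventually_forall_exists_dist_lt hR hrR hR₁ hδ]
  rintro j hj w ⟨hw, hwr : ‖w‖ < r⟩
  obtain ⟨l, hl, hlR, hwl⟩ := hj w hw hwr.le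
  exact Set.mem_biUnion (hF ⟨hl, hlR⟩) ⟨hw, hδV l (hF ⟨hl, hlR⟩) hwl⟩

lemma WeaklyConverges.eventually_exists_dist_lt (h : WeaklyConverges M Λ) {l : ℂ} (hl : l ∈ Λ)
    (hd : l ∈ disk) {ε : ℝ} (hε : 0 < ε) : ∀ᶠ j in atTop, ∃ w ∈ M j, dist l w < ε := by
  obtain ⟨R, hlR, hR₁⟩ := exists_between (mem_disk.mp hd)
  have hR : 0 < R := (norm_nonneg l).trans_lt hlR
  filter_upwards [(h 0 R hR (Metric.closedBall_subset_ball hR₁)).eventually_lt_const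
    (ENNReal.ofReal_pos.mpr (lt_min hε (sub_pos.mpr hlR)))] with j hj
  rw [Metric.hausdorffEDist_comm] at hj
  obtain ⟨w, hw, -, hlw⟩ := exists_mem_dist_lt_of_hausdorffEDist_lt hj hl
    (by linarith [min_le_right ε (R - ‖l‖)])
  exact ⟨w, hw, hlw.trans_le (min_le_left _ _)⟩

lemma WeaklyConverges.exists_tendsto (h : WeaklyConverges M Λ) {l : ℂ} (hl : l ∈ Λ)
    (hd : l ∈ disk) : ∃ u : ℕ → ℂ, (∀ᶠ j in atTop, u j ∈ M j) ∧ Tendsto u atTop (𝓝 l) := by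
  have hnear : ∀ j : ℕ, (M j).Nonempty →
      ∃ w ∈ M j, dist l w < Metric.infDist l (M j) + 1 / (j + 1) := fun j hj =>
    (Metric.infDist_lt_iff hj).mp (lt_add_of_pos_right _ (by positivity))
  choose! u huM hu using hnear
  have hne : ∀ᶠ j in atTop, (M j).Nonempty :=
    (h.eventually_exists_dist_lt hl hd one_pos).mono fun j ⟨w, hw, _⟩ => ⟨w, hw⟩
  have hinf : Tendsto (fun j => Metric.infDist l (M j)) atTop (𝓝 0) := by
    refine Metric.tendsto_nhds.mpr fun ε hε => ?_
    filter_upwards [h.eventually_exists_dist_lt hl hd hε] with j ⟨w, hw, hlw⟩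
    rw [Real.dist_0_eq_abs, abs_of_nonneg Metric.infDist_nonneg]
    exact (Metric.infDist_le_dist_of_mem hw).trans_lt hlw
  refine ⟨u, hne.mono huM, tendsto_iff_dist_tendsto_zero.mpr ?_⟩
  refine squeeze_zero' (.of_forall fun j => dist_nonneg)
    (hne.mono fun j hj => dist_comm l _ ▸ (hu j hj).le) ?_
  simpa only [add_zero] using hinf.add tendsto_one_div_add_atTop_nhds_zero_nat

lemma WeaklyConverges.tsum_le (h : WeaklyConverges M Λ) (hΛ : Λ ⊆ disk) (hg : Continuous g)
    {C : ℝ≥0∞} (hC : ∀ᶠ j in atTop, ∑' z : M j, g z ≤ C) : ∑' z : Λ, g z ≤ C := by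
  rw [ENNReal.tsum_eq_iSup_sum]
  refine iSup_le fun F => ?_
  choose u huM hu using fun z : Λ => h.exists_tendsto z.2 (hΛ z.2)
  have hmem : ∀ᶠ j in atTop, ∀ z ∈ F, u z j ∈ M j :=
    (eventually_all_finset F).mpr fun z _ => huM z
  have hinj : ∀ᶠ j in atTop, ∀ z ∈ F, ∀ w ∈ F, u z j = u w j → z = w := by
    refine (eventually_all_finset F).mpr fun z _ => (eventually_all_finset F).mpr fun w _ => ?_
    rcases eq_or_ne z w with rfl | hzw
    · exact .of_forall fun _ _ => rfl
    · have hne : ∀ᶠ x : ℂ × ℂ in 𝓝 (↑z, ↑w), x.1 ≠ x.2 :=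
        (isOpen_ne_fun continuous_fst continuous_snd).eventually_mem (Subtype.coe_ne_coe.mpr hzw)
      exact (((hu z).prodMk_nhds (hu w)).eventually hne).mono fun _ h h' => (h h').elim
  refine le_of_tendsto (tendsto_finsetSum F fun z _ => (hg.tendsto _).comp (hu z)) ?_
  filter_upwards [hmem, hinj, hC] with j hjM hj hjC
  classical
  calc ∑ z ∈ F, g (u z j)
    _ = ∑ w ∈ F.image (u · j), g w := (Finset.sum_image fun z hz w hw => hj z hz w hw).symm
    _ = ∑' w : (F.image (u · j) : Set ℂ), g w := (Finset.tsum_subtype' _ _).symm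
    _ ≤ ∑' w : M j, g w := ENNReal.tsum_mono_subtype g fun w hw => by
      obtain ⟨z, hz, rfl⟩ := Finset.mem_image.mp hw
      exact hjM z hz
    _ ≤ C := hjC

lemma tsum_le_sum_mul_of_subset_biUnion {α ι : Type*} {F : Finset ι} {S : Set α} {V : ι → Set α}
    {g : α → ℝ≥0∞} {b : ι → ℝ≥0∞} {K : ℝ≥0∞} (hS : S ⊆ ⋃ i ∈ F, V i)
    (hK : ∀ i ∈ F, ((V i).encard : ℝ≥0∞) ≤ K) (hb : ∀ i ∈ F, ∀ z ∈ V i, g z ≤ b i) :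
    ∑' z : S, g z ≤ ∑ i ∈ F, K * b i :=
  calc ∑' z : S, g z ≤ ∑' z : ↑(⋃ i ∈ F, V i), g z := ENNReal.tsum_mono_subtype g hS
    _ ≤ ∑ i ∈ F, ∑' z : V i, g z := ENNReal.tsum_biUnion_le g F _
    _ ≤ ∑ i ∈ F, ∑' _ : V i, b i := by
      gcongr with i hi z
      exact hb i hi z z.2
    _ ≤ ∑ i ∈ F, K * b i := by
      gcongr with i hi
      rw [ENNReal.tsum_set_const]
      gcongr
      exact hK i hi

lemma WeaklyConverges.le_mul_tsum (h : WeaklyConverges M Λ) (hg : Continuous g)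
    (hg' : ∀ z, g z ≠ ∞) {r R : ℝ} (hR : 0 < R) (hrR : r < R) (hR₁ : R < 1)
    (hfin : (Λ ∩ {z | ‖z‖ ≤ R}).Finite) {K : ℝ≥0∞} (hK : K ≠ ∞)
    (hmult : ∀ l ∈ Λ, ∃ U ∈ 𝓝 l, ∀ᶠ j in atTop, ((M j ∩ U).encard : ℝ≥0∞) ≤ K) {c : ℝ≥0∞}
    (hc : ∀ᶠ j in atTop, c ≤ ∑' z : ↑(M j ∩ {z | ‖z‖ < r}), g z) :
    c ≤ K * ∑' z : Λ, g z := by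
  choose! U hU hUK using hmult
  set F := hfin.toFinset
  have hF : ∀ l ∈ F, l ∈ Λ := fun l hl => (hfin.mem_toFinset.mp hl).1
  have hbound : ∀ ε : ℝ≥0∞, 0 < ε → c ≤ ∑ l ∈ F, K * (g l + ε) := by
    intro ε hε
    set V : ℂ → Set ℂ := fun l => U l ∩ {z | g z < g l + ε}
    have hV : ∀ l ∈ F, V l ∈ 𝓝 l := fun l hl => inter_mem (hU l (hF l hl))
      (hg.continuousAt.eventually_lt_const (ENNReal.lt_add_right (hg' l) hε.ne'))
    have hcount : ∀ᶠ j in atTop, ∀ l ∈ F, ((M j ∩ U l).encard : ℝ≥0∞) ≤ K :=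
      (eventually_all_finset F).mpr fun l hl => hUK l (hF l hl)
    obtain ⟨j, hjc, hjK, hcover⟩ := (hc.and (hcount.and
      (h.eventually_inter_subset_biUnion hR hrR hR₁ hfin.coe_toFinset.ge hV))).exists
    exact hjc.trans (tsum_le_sum_mul_of_subset_biUnion hcover
      (fun l hl => le_trans (by gcongr; exact Set.inter_subset_left) (hjK l hl))
      fun l _ z hz => hz.2.2.le)
  have hlim : Tendsto (fun ε => ∑ l ∈ F, K * (g l + ε)) (𝓝[>] 0)
      (𝓝 (∑ l ∈ F, K * (g l + 0))) :=
    tendsto_finsetSum F fun l _ => ENNReal.Tendsto.const_mul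
      (tendsto_const_nhds.add (tendsto_id.mono_left nhdsWithin_le_nhds)) (Or.inr hK)
  calc c ≤ ∑ l ∈ F, K * (g l + 0) := ge_of_tendsto hlim (eventually_mem_nhdsWithin.mono hbound)
    _ = K * ∑ l ∈ F, g l := by simp only [add_zero, Finset.mul_sum]
    _ ≤ K * ∑' z : Λ, g z := by
      gcongr
      rw [← Finset.tsum_subtype']
      exact ENNReal.tsum_mono_subtype g hF

end WeakLimit

section PolynomialApproximation

variable {K : ℂ → ℂ → ℂ} {A B : ℝ} {Λ : Set ℂ} {f : ℂ → ℂ}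

lemma IsCarleson.samplingSum_le (h : ∀ N, IsCarleson K N B Λ) (hΛ : Λ ⊆ disk)
    (hf : MemBergman f) : samplingSum K Λ f ≤ ENNReal.ofReal (B * normSq f) := by
  obtain ⟨a, ha⟩ := exists_hasSum_of_differentiableOn hf.1
  rw [samplingSum, ENNReal.tsum_eq_iSup_sum]
  refine iSup_le fun F => ?_
  have hpt : ∀ z : Λ, Tendsto (fun n => ((PowerSeries.mk a).trunc n).eval (z : ℂ)) atTop
      (𝓝 (f z)) := fun z => by
    simpa only [eval_trunc_mk] using (ha z (hΛ z.2)).tendsto_sum_nat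
  refine le_of_tendsto_of_tendsto'
    (tendsto_finsetSum F fun z _ => ENNReal.tendsto_ofReal (((hpt z).norm.pow 2).div_const _))
    (ENNReal.tendsto_ofReal ((hf.tendsto_normSq_trunc ha).const_mul B)) fun n => ?_
  exact (ENNReal.sum_le_tsum F).trans (h _ _ le_rfl)

lemma half_mul_normSq_le_samplingSum (hup : ∀ N, IsCarleson K N B Λ) (hΛ : Λ ⊆ disk)
    (hlow : ∀ p : Polynomial ℂ, ENNReal.ofReal (A * normSq fun z => p.eval z) ≤
      samplingSum K Λ fun z => p.eval z) (hf : MemBergman f) :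
    ENNReal.ofReal (A / 2 * normSq f) ≤ samplingSum K Λ f := by
  obtain ⟨a, ha⟩ := exists_hasSum_of_differentiableOn hf.1
  set p : ℕ → Polynomial ℂ := fun n => (PowerSeries.mk a).trunc n
  have hle : ∀ n, ENNReal.ofReal (A * normSq fun z => (p n).eval z) ≤
      2 * samplingSum K Λ f +
        2 * ENNReal.ofReal (B * normSq fun z => f z - (p n).eval z) := by
    intro n
    refine (hlow (p n)).trans ((samplingSum_le_two_mul_add (f := f)).trans ?_)
    gcongr
    exact IsCarleson.samplingSum_le hup hΛ (hf.sub (memBergman_eval (p n)))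
  have hlim := le_of_tendsto_of_tendsto'
    (ENNReal.tendsto_ofReal ((hf.tendsto_normSq_trunc ha).const_mul A))
    (tendsto_const_nhds.add (ENNReal.Tendsto.const_mul
      (ENNReal.tendsto_ofReal ((hf.tendsto_normSq_sub_trunc ha).const_mul B)) (by simp))) hle
  rw [mul_zero, ENNReal.ofReal_zero, mul_zero, add_zero,
    show A * normSq f = 2 * (A / 2 * normSq f) by ring, ENNReal.ofReal_mul zero_le_two,
    ENNReal.ofReal_ofNat] at hlim
  exact (ENNReal.mul_le_mul_iff_right (by simp) (by simp)).mp hlim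

end PolynomialApproximation

section WeakLimitOfSamplingSums

variable {A B r : ℝ} {N : ℕ} {M Λs : ℕ → Set ℂ} {Λ : Set ℂ}

lemma exists_polynomial_normSq_lt {l : ℂ} (hl : l ∈ disk) :
    ∃ p : Polynomial ℂ, 0 < (normSq fun z => p.eval z) ∧
      (normSq fun z => p.eval z) < 2 * (‖p.eval l‖ ^ 2 * (1 - ‖l‖ ^ 2) ^ 2) := by
  have hx : 0 < 1 - ‖l‖ ^ 2 := sub_pos.mpr (sq_norm_lt_one hl)
  set D : ℕ → ℝ := fun n => ∑ j ∈ Finset.range n, (j + 1 : ℝ) * (‖l‖ ^ 2) ^ j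
  have hD : Tendsto D atTop (𝓝 ((1 - ‖l‖ ^ 2) ^ 2)⁻¹) :=
    (hasSum_add_one_mul_pow (sq_nonneg _) (sq_norm_lt_one hl)).tendsto_sum_nat
  obtain ⟨n, hn⟩ := (hD.eventually_const_lt
    (half_lt_self (inv_pos.mpr (pow_pos hx 2)))).exists
  rw [inv_eq_one_div, div_div, div_lt_iff₀ (by positivity)] at hn
  have hDn : 0 < D n := pos_of_mul_pos_left (one_pos.trans hn) (by positivity)
  -- The truncated reproducing kernel at `l`: its squared norm and its value at `l` are both `D n`.
  refine ⟨(PowerSeries.mk fun j => ((j + 1 : ℝ) : ℂ) * starRingEnd ℂ l ^ j).trunc n, ?_⟩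
  have hnorm : (normSq fun z => ((PowerSeries.mk fun j =>
      ((j + 1 : ℝ) : ℂ) * starRingEnd ℂ l ^ j).trunc n).eval z) = D n := by
    rw [normSq_eval_trunc]
    refine Finset.sum_congr rfl fun j _ => ?_
    rw [norm_mul, norm_pow, Complex.norm_conj, Complex.norm_of_nonneg (by positivity),
      pow_right_comm]
    field_simp
  have heval : ((PowerSeries.mk fun j =>
      ((j + 1 : ℝ) : ℂ) * starRingEnd ℂ l ^ j).trunc n).eval l = (D n : ℂ) := by
    rw [eval_trunc_mk, Complex.ofReal_sum]
    refine Finset.sum_congr rfl fun j _ => ?_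
    rw [mul_assoc, ← mul_pow, Complex.conj_mul']
    norm_cast
  rw [hnorm, heval, Complex.norm_of_nonneg hDn.le]
  exact ⟨hDn, by nlinarith⟩

lemma exists_mem_nhds_encard_le {l : ℂ} (hl : l ∈ disk) :
    ∃ N, ∃ U ∈ 𝓝 l, ∀ B Λ, IsCarleson kernel N B Λ →
      ((Λ ∩ U).encard : ℝ≥0∞) ≤ ENNReal.ofReal (2 * B) := by
  obtain ⟨p, hp, hpl⟩ := exists_polynomial_normSq_lt hl
  set ν := normSq fun z => p.eval z
  set U : Set ℂ := {z | ν / 2 < ‖p.eval z‖ ^ 2 * (1 - ‖z‖ ^ 2) ^ 2}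
  have hU : IsOpen U := isOpen_lt continuous_const (by fun_prop)
  refine ⟨p.natDegree, U, hU.mem_nhds (show ν / 2 < _ by linarith), fun B Λ h => ?_⟩
  have hν : 0 < ν / 2 := half_pos hp
  refine (ENNReal.mul_le_mul_iff_left (ENNReal.ofReal_pos.mpr hν).ne' ENNReal.ofReal_ne_top).mp ?_
  calc ((Λ ∩ U).encard : ℝ≥0∞) * ENNReal.ofReal (ν / 2)
    _ = ∑' _ : ↑(Λ ∩ U), ENNReal.ofReal (ν / 2) := (ENNReal.tsum_set_const _ _).symm
    _ ≤ samplingSum kernel (Λ ∩ U) fun z => p.eval z := by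
      rw [samplingSum_kernel]
      exact ENNReal.tsum_le_tsum fun z => ENNReal.ofReal_le_ofReal (le_of_lt z.2.2)
    _ ≤ ENNReal.ofReal (B * ν) := (samplingSum_mono Set.inter_subset_left).trans (h p le_rfl)
    _ = ENNReal.ofReal (2 * B) * ENNReal.ofReal (ν / 2) := by
      rw [← ENNReal.ofReal_mul' hν.le]
      ring_nf

lemma WeaklyConverges.isCarleson (h : WeaklyConverges M Λ) (hΛ : Λ ⊆ disk)
    (hM : ∀ᶠ j in atTop, IsCarleson kernel N B (M j)) : IsCarleson kernel N B Λ := by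
  intro p hp
  rw [samplingSum_kernel]
  refine h.tsum_le (g := fun z => ENNReal.ofReal (‖p.eval z‖ ^ 2 * (1 - ‖z‖ ^ 2) ^ 2)) hΛ
    (ENNReal.continuous_ofReal.comp (by fun_prop)) (hM.mono fun j hj => ?_)
  simpa only [samplingSum_kernel] using hj p hp

lemma WeaklyConverges.le_samplingSum (h : WeaklyConverges M Λ) (hΛ : Λ ⊆ disk)
    (hM : ∀ N, ∀ᶠ j in atTop, IsCarleson kernel N B (M j)) (hr : r < 1) (p : Polynomial ℂ)
    {c : ℝ≥0∞}
    (hc : ∀ᶠ j in atTop, c ≤ samplingSum kernel (M j ∩ {z | ‖z‖ < r}) fun z => p.eval z) :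
    c ≤ ENNReal.ofReal (2 * B) * samplingSum kernel Λ fun z => p.eval z := by
  obtain ⟨R, hrR, hR₁⟩ := exists_between (max_lt hr zero_lt_one)
  obtain ⟨hrR, hR₀⟩ := max_lt_iff.mp hrR
  simp only [samplingSum_kernel] at hc ⊢
  refine h.le_mul_tsum (g := fun z => ENNReal.ofReal (‖p.eval z‖ ^ 2 * (1 - ‖z‖ ^ 2) ^ 2))
    (ENNReal.continuous_ofReal.comp (by fun_prop)) (fun _ => ENNReal.ofReal_ne_top) hR₀ hrR hR₁
    ((h.isCarleson hΛ (hM 0)).finite_inter_norm_le hR₁) ENNReal.ofReal_ne_top (fun l hl => ?_) hc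
  obtain ⟨N, U, hU, hmult⟩ := exists_mem_nhds_encard_le (hΛ hl)
  exact ⟨U, hU, (hM N).mono fun j hj => hmult B _ hj⟩

lemma eventually_isCarleson_kernel (hdisk : ∀ n, Λs n ⊆ disk)
    (h : ∀ᶠ n in atTop, IsCarleson (polyKernel n) n B (Λs n)) (N : ℕ) :
    ∀ᶠ n in atTop, IsCarleson kernel N B (Λs n) := by
  filter_upwards [h, eventually_ge_atTop N] with n hn hNn p hp
  exact (samplingSum_kernel_le_polyKernel (hdisk n) n).trans (hn p (hp.trans hNn))

lemma eventually_pow_half_le_half (hr₀ : 0 ≤ r) (hr : r < 1) :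
    ∀ᶠ n : ℕ in atTop, r ^ (n / 2 + 1) ≤ 1 / 2 := by
  have hexp : Tendsto (fun n : ℕ => n / 2 + 1) atTop atTop :=
    (tendsto_add_atTop_nat 1).comp (Nat.tendsto_div_const_atTop two_ne_zero)
  exact ((tendsto_pow_atTop_nhds_zero_of_lt_one hr₀ hr).comp hexp).eventually_le_const
    (by norm_num)

lemma exists_lt_one_half_le_pow (m : ℕ) : ∃ r : ℝ, 0 ≤ r ∧ r < 1 ∧ 1 / 2 ≤ r ^ m := by
  have hcont : Tendsto (fun r : ℝ => r ^ m) (𝓝[<] 1) (𝓝 (1 ^ m)) :=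
    ((continuous_pow m).tendsto 1).mono_left nhdsWithin_le_nhds
  have hlt : ∀ᶠ r : ℝ in 𝓝[<] 1, r ∈ Set.Ioo 0 1 := Ioo_mem_nhdsLT zero_lt_one
  obtain ⟨r, hr, hrm⟩ :=
    (hlt.and (hcont.eventually_const_le (by norm_num : 1 / 2 < (1 : ℝ) ^ m))).exists
  exact ⟨r, hr.1.le, hr.2, hrm⟩

lemma exists_eventually_le_samplingSum_inner (hdisk : ∀ n, Λs n ⊆ disk) (hA : 0 < A) (hB : 0 ≤ B)
    (hup : ∀ᶠ n in atTop, IsCarleson (polyKernel n) n B (Λs n)) (p : Polynomial ℂ)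
    (hlow : ∀ᶠ n in atTop, ENNReal.ofReal (A * normSq fun z => p.eval z) ≤
      samplingSum (polyKernel n) (Λs n) fun z => p.eval z) :
    ∃ r < 1, ∀ᶠ n in atTop, ENNReal.ofReal (A / 8 * normSq fun z => p.eval z) ≤
      samplingSum kernel (Λs n ∩ {z | ‖z‖ < r}) fun z => p.eval z := by
  obtain ⟨m, hm⟩ := exists_nat_ge (4 * B * (p.natDegree + 1) / A)
  rw [div_le_iff₀' hA] at hm
  obtain ⟨r, hr₀, hr₁, hr⟩ := exists_lt_one_half_le_pow (2 * m)
  refine ⟨r, hr₁, ?_⟩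
  filter_upwards [hup, hlow, eventually_ge_atTop (p.natDegree + m),
    eventually_pow_half_le_half (sq_nonneg r) (pow_lt_one₀ hr₀ hr₁ two_ne_zero)]
    with n hupn hlown hn hrn
  have hcarl : IsCarleson (polyKernel n) (p.natDegree + m) B (Λs n) := fun q hq =>
    hupn q (hq.trans hn)
  have hinner : ENNReal.ofReal (A / 2 * normSq fun z => p.eval z) ≤
      samplingSum (polyKernel n) (Λs n ∩ {z | ‖z‖ < r}) fun z => p.eval z :=
    hcarl.half_mul_normSq_le_samplingSum_inner hB hr₀ hr
      (by nlinarith [p.natDegree.cast_nonneg (α := ℝ)]) le_rfl hlown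
  have hcomp : samplingSum (polyKernel n) (Λs n ∩ {z | ‖z‖ < r}) (fun z => p.eval z) ≤
      ENNReal.ofReal ((1 - 1 / 2) ^ 2)⁻¹ *
        samplingSum kernel (Λs n ∩ {z | ‖z‖ < r}) fun z => p.eval z := by
    refine samplingSum_polyKernel_le (Set.inter_subset_left.trans (hdisk n)) (by norm_num) ?_
    rintro z ⟨-, hz : ‖z‖ < r⟩
    exact le_trans (by gcongr) hrn
  have h := hinner.trans hcomp
  rw [show A / 2 * normSq (fun z => p.eval z) =
    ((1 - 1 / 2) ^ 2)⁻¹ * (A / 8 * normSq fun z => p.eval z) by ring,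
    ENNReal.ofReal_mul (by norm_num)] at h
  exact (ENNReal.mul_le_mul_iff_right (ENNReal.ofReal_pos.mpr (by norm_num)).ne'
    ENNReal.ofReal_ne_top).mp h

theorem IsMZFamily.isSampling (hΛs : IsMZFamily Λs) {φ : ℕ → ℕ} (hφ : StrictMono φ)
    (hΛ : Λ ⊆ disk) (hW : WeaklyConverges (fun j => Λs (φ j)) Λ) : IsSampling Λ := by
  obtain ⟨hdisk, A, B, hA, hB, n₀, hMZ⟩ := hΛs
  have hup : ∀ᶠ n in atTop, IsCarleson (polyKernel n) n B (Λs n) :=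
    (eventually_ge_atTop n₀).mono fun n hn p hp => ((hMZ n hn).2 p hp).2
  have hlow : ∀ p : Polynomial ℂ, ∀ᶠ n in atTop, ENNReal.ofReal (A * normSq fun z => p.eval z) ≤
      samplingSum (polyKernel n) (Λs n) fun z => p.eval z := fun p => by
    filter_upwards [eventually_ge_atTop n₀, eventually_ge_atTop p.natDegree] with n hn hpn
    exact ((hMZ n hn).2 p hpn).1
  have hM : ∀ N, ∀ᶠ j in atTop, IsCarleson kernel N B (Λs (φ j)) := fun N =>
    hφ.tendsto_atTop.eventually (eventually_isCarleson_kernel hdisk hup N)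
  have hcarl : ∀ N, IsCarleson kernel N B Λ := fun N => hW.isCarleson hΛ (hM N)
  have hpoly : ∀ p : Polynomial ℂ, ENNReal.ofReal (A / (16 * B) * normSq fun z => p.eval z) ≤
      samplingSum kernel Λ fun z => p.eval z := by
    intro p
    obtain ⟨r, hr, hc⟩ := exists_eventually_le_samplingSum_inner hdisk hA hB.le hup p (hlow p)
    have h := hW.le_samplingSum hΛ hM hr p (hφ.tendsto_atTop.eventually hc)
    rw [show A / 8 * normSq (fun z => p.eval z) =
      2 * B * (A / (16 * B) * normSq fun z => p.eval z) by field_simp; ring,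
      ENNReal.ofReal_mul (by positivity)] at h
    exact (ENNReal.mul_le_mul_iff_right (ENNReal.ofReal_pos.mpr (by positivity)).ne'
      ENNReal.ofReal_ne_top).mp h
  exact ⟨hΛ, A / (16 * B) / 2, B, by positivity, hB, fun f hf =>
    ⟨half_mul_normSq_le_samplingSum hcarl hΛ hpoly hf, IsCarleson.samplingSum_le hcarl hΛ hf⟩⟩

end WeakLimitOfSamplingSums

end BergmanMZ

theorem theorem1p1 :
    (∀ Λ : Set ℂ, BergmanMZ.IsSampling Λ →
      ∃ γ₀ : ℝ, 0 < γ₀ ∧ ∀ γ : ℝ, 0 < γ → γ < γ₀ →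
        BergmanMZ.IsMZFamily (fun n : ℕ => Λ ∩ {z : ℂ | ‖z‖ < 1 - γ / (n : ℝ)})) ∧
    (∀ Λs : ℕ → Set ℂ, BergmanMZ.IsMZFamily Λs →
      ∀ φ : ℕ → ℕ, StrictMono φ →
        ∀ Λ : Set ℂ, Λ ⊆ BergmanMZ.disk →
          BergmanMZ.WeaklyConverges (fun j => Λs (φ j)) Λ → BergmanMZ.IsSampling Λ) := by
  exact ⟨fun _ hΛ => hΛ.exists_isMZFamily, fun _ hS _ hφ _ hΛ hW => hS.isSampling hφ hΛ hW⟩
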